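/- For $n\ge 1$ let $\mathrm{Sym}(n,\mathbb{R})$ be the space of real symmetric $n\times n$ matrices with Lebesgue measure $dA=\prod_{1\le i\le j\le n}dA_{ij}$, let $\|A\|=\sqrt{\operatorname{tr}(A^2)}$, and let $N=\frac{n(n+1)}{2}$. $\mathrm{GOE}(n)$ is the measure $$\mathbb{P}\{U\}=\frac{1}{\sqrt{2}^{\,n}\sqrt{\pi}^{\,N}}\int_U e^{-\|A\|^2/2}\,dA$$ on $\mathrm{Sym}(n,\mathbb{R})$. Let $H_i(x)=(-1)^i e^{x^2}\frac{d^i}{dx^i}e^{-x^2}$, $i\ge 0$, be the (physicist's) Hermite polynomials. **Proposition (second moment of the characteristic polynomial).** Fix a positive integer $k$ and $u\in\mathbb{R}$. Then $\mathrm{GOE}(k)$ is a probability measure, $Q\mapsto\det(Q-u\mathbb{1})^2$ is integrable with respect to it, and the following holds. 1. If $k=2m$ is even, then $$\mathbb{E}_{Q\sim\mathrm{GOE}(k)}\det(Q-u\mathbb{1})^2=\frac{(2m)!}{2^{2m}}\sum_{j=0}^m\frac{2^{-2j-1}}{(2j)!}\,\det X_j(u),$$ where $$X_j(u)=\begin{pmatrix}H_{2j}(u)&H_{2j}'(u)\\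 H_{2j+1}(u)-H_{2j}'(u)&H_{2j+1}'(u)-H_{2j}''(u)\end{pmatrix}.$$ 2. If $k=2m+1$ is odd, then $$\mathbb{E}_{Q\sim\mathrm{GOE}(k)}\det(Q-u\mathbb{1})^2=\frac{\sqrt{\pi}\,(2m+1)!}{2^{4m+2}\,\Gamma(m+\tfrac32)}\sum_{j=0}^m\frac{2^{-2j-2}}{(2j)!}\,\det Y_j(u),$$ where $$Y_j(u)=\begin{pmatrix}\frac{(2j)!}{j!}&H_{2j}(u)&H_{2j}'(u)\\ 0&H_{2j+1}(u)-H_{2j}'(u)&H_{2j+1}'(u)-H_{2j}''(u)\\ \frac{(2m+2)!}{(m+1)!}&H_{2m+2}(u)&H_{2m+2}'(u)\end{pmatrix}.$$ -/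

import Mathlib

open MeasureTheory

noncomputable section

namespace GOEMoment

/-- The space of real symmetric `n × n` matrices. -/
abbrev SymMat (n : ℕ) : Type := {A : Matrix (Fin n) (Fin n) ℝ // A.IsSymm}

/-- The Borel σ-algebra on symmetric matrices, generated by the matrix entries. -/
instance SymMat.instMeasurableSpace (n : ℕ) : MeasurableSpace (SymMat n) :=
  MeasurableSpace.comap (fun A => (fun i j => A.1 i j : Fin n → Fin n → ℝ)) MeasurableSpace.pi

/-- The index set of the entries on and above the diagonal. -/
abbrev UpperIdx (n : ℕ) : Type := {p : Fin n × Fin n // p.1 ≤ p.2}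

/-- The symmetric matrix whose entries on and above the diagonal are `x`. -/
def symOfUpper (n : ℕ) (x : UpperIdx n → ℝ) : SymMat n :=
  ⟨Matrix.of fun i j => x ⟨(min i j, max i j), min_le_max⟩, by
    ext i j
    simp [Matrix.transpose_apply, min_comm, max_comm]⟩

/-- The parametrization by the upper triangle is measurable, so that pushing a measure forward
along it is meaningful. -/
theorem measurable_symOfUpper (n : ℕ) : Measurable (symOfUpper n) := by
  refine Measurable.of_comap_le ?_
  rw [SymMat.instMeasurableSpace, MeasurableSpace.comap_comp]
  refine Measurable.comap_le ?_
  refine measurable_pi_lambda _ fun i => measurable_pi_lambda _ fun j => ?_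
  exact measurable_pi_apply _

/-- The Lebesgue measure `dA = ∏_{i ≤ j} dA_ij` on symmetric matrices. -/
def lebesgueSym (n : ℕ) : Measure (SymMat n) :=
  Measure.map (symOfUpper n) (volume : Measure (UpperIdx n → ℝ))

/-- The Frobenius norm `‖A‖ = √(tr (A²))` of a symmetric matrix. -/
def frobeniusNorm {n : ℕ} (A : SymMat n) : ℝ := √((A.1 ^ 2).trace)

/-- The Gaussian Orthogonal Ensemble `GOE(n)`: the measure on symmetric matrices with density
`(√2 ^ n * √π ^ N)⁻¹ * exp (-‖A‖² / 2)` with respect to `dA`, where `N = n (n + 1) / 2`. -/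
def GOE (n : ℕ) : Measure (SymMat n) :=
  (lebesgueSym n).withDensity fun A =>
    ENNReal.ofReal
      (1 / (√2 ^ n * √Real.pi ^ (n * (n + 1) / 2)) * Real.exp (-(frobeniusNorm A ^ 2) / 2))

/-- The physicist's Hermite polynomial `H_i(x) = (-1)^i e^{x²} (d/dx)^i e^{-x²}`, as a function. -/
def hermiteH (i : ℕ) (x : ℝ) : ℝ :=
  (-1) ^ i * Real.exp (x ^ 2) * iteratedDeriv i (fun t : ℝ => Real.exp (-(t ^ 2))) x

/-- The first derivative `H_i'`. -/
def hermiteH' (i : ℕ) (x : ℝ) : ℝ := deriv (hermiteH i) x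

/-- The second derivative `H_i''`. -/
def hermiteH'' (i : ℕ) (x : ℝ) : ℝ := deriv (hermiteH' i) x

/-- The matrix `X_j(u)`. -/
def matX (j : ℕ) (u : ℝ) : Matrix (Fin 2) (Fin 2) ℝ :=
  !![hermiteH (2 * j) u, hermiteH' (2 * j) u;
     hermiteH (2 * j + 1) u - hermiteH' (2 * j) u, hermiteH' (2 * j + 1) u - hermiteH'' (2 * j) u]

/-- The matrix `Y_j(u)`; it depends also on `m`. -/
def matY (m j : ℕ) (u : ℝ) : Matrix (Fin 3) (Fin 3) ℝ :=
  !![((2 * j).factorial : ℝ) / (j.factorial : ℝ), hermiteH (2 * j) u, hermiteH' (2 * j) u;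
     0, hermiteH (2 * j + 1) u - hermiteH' (2 * j) u,
       hermiteH' (2 * j + 1) u - hermiteH'' (2 * j) u;
     ((2 * m + 2).factorial : ℝ) / ((m + 1).factorial : ℝ), hermiteH (2 * m + 2) u,
       hermiteH' (2 * m + 2) u]

end GOEMoment

end

/-! ### Determinants of bordered matrices. -/

namespace Matrix

/-! In the upper-triangular coordinates the entries of a `GOE(k)` matrix are independent centred
Gaussians, of variance 1 on the diagonal and 1/2 off it. On polynomials in the entries their
expectation `E` satisfies Stein's identity `IsStein`, and this identity with `E 1 = 1` is all that
the moment computation uses.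

Border a principal minor with determinant `d` and adjugate `S` by one more row and column. The new
determinant is affine in the new diagonal entry and quadratic in the other new entries, so
integrating out the new row (`bordered_sq`, `bordered_mul_bordered`, `bordered_of_ne_sq`) expresses
its second moments through those of `d²`, `d tr S`, `(tr S)²` and `tr S²`. The cofactors of a matrix
are themselves bordered minors, so these four moments satisfy a closed recursion in the size.
Explicit expressions in monic Hermite polynomials solve it, and `hasMoments` concludes by induction
over all principal submatrices of one fixed matrix.

The resulting value `D n` satisfies `D (n+1) - (n+1)/2 * D n = W`, with `W` the Wronskian of
consecutive monic Hermite polynomials (`detSqMoment_succ_eq`). Two such steps give `det X_j`, so the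
even sum telescopes. Expanding `det Y_j` along its first column gives the even sum again plus two
telescoping sums that produce one last Wronskian, which is the step from `2m` to `2m+1`. -/

/-- Expansion of a determinant along its first row and first column. -/
theorem det_succ_eq_sub_sum_adjugate {R : Type*} [CommRing R] {n : ℕ}
    (N : Matrix (Fin (n + 1)) (Fin (n + 1)) R) :
    N.det = N 0 0 * (N.submatrix Fin.succ Fin.succ).det -
      ∑ i, ∑ j, N 0 (Fin.succ i) * N (Fin.succ j) 0 *
        (N.submatrix Fin.succ Fin.succ).adjugate i j := by
  rw [det_succ_row_zero, Fin.sum_univ_succ, sub_eq_add_neg, ← Finset.sum_neg_distrib]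
  congr 1
  · simp [Fin.succAbove_zero]
  · refine Finset.sum_congr rfl fun i _ => ?_
    cases n with
    | zero => exact i.elim0
    | succ n =>
      rw [det_succ_column_zero, Finset.mul_sum, ← Finset.sum_neg_distrib]
      refine Finset.sum_congr rfl fun j _ => ?_
      rw [adjugate_fin_succ_eq_det_submatrix]
      have h : (N.submatrix Fin.succ (Fin.succAbove i.succ)).submatrix (Fin.succAbove j) Fin.succ =
          (N.submatrix Fin.succ Fin.succ).submatrix (Fin.succAbove j) (Fin.succAbove i) := by
        ext a b
        simp [Fin.succ_succAbove_succ]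
      rw [h]
      simp only [submatrix_apply, Fin.succ_succAbove_zero, Fin.val_succ, pow_succ, pow_add]
      ring

theorem det_mem_of_forall_mem {R ι : Type*} [CommRing R] [Fintype ι] [DecidableEq ι]
    {A : Type*} [CommRing A] [Algebra A R] (K : Subalgebra A R) {N : Matrix ι ι R}
    (h : ∀ i j, N i j ∈ K) : N.det ∈ K := by
  rw [det_apply]
  exact sum_mem fun σ _ => by
    rw [Units.smul_def]
    exact zsmul_mem (prod_mem fun i _ => h _ _) _

theorem adjugate_mem_of_forall_mem {R ι : Type*} [CommRing R] [Fintype ι] [DecidableEq ι]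
    {A : Type*} [CommRing A] [Algebra A R] (K : Subalgebra A R) {N : Matrix ι ι R}
    (h : ∀ i j, N i j ∈ K) (i j : ι) : N.adjugate i j ∈ K := by
  rw [adjugate_apply]
  refine det_mem_of_forall_mem K fun a b => ?_
  rw [updateRow_apply]
  split_ifs
  · rw [Pi.single_apply]
    split_ifs
    exacts [one_mem _, zero_mem _]
  · exact h _ _

end Matrix

/-! ### Stein's identity and Gaussian moments along one row. -/

namespace GOEMoment

open MvPolynomial

variable {k : ℕ}

/-- The index of the entry `(i, j)` of a symmetric matrix. -/
def upperIdx (i j : Fin k) : UpperIdx k := ⟨(min i j, max i j), min_le_max⟩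

theorem upperIdx_comm (i j : Fin k) : upperIdx i j = upperIdx j i := by
  simp [upperIdx, min_comm, max_comm]

theorem upperIdx_eq_iff {a b c d : Fin k} :
    upperIdx a b = upperIdx c d ↔ (a = c ∧ b = d) ∨ (a = d ∧ b = c) := by
  simp only [upperIdx, Subtype.mk.injEq, Prod.mk.injEq, min_def, max_def]
  split_ifs <;> omega

/-- The variance of an entry of a `GOE` matrix. -/
noncomputable def entryVar (z : UpperIdx k) : ℝ := if z.1.1 = z.1.2 then 1 else 1 / 2

theorem entryVar_self (a : Fin k) : entryVar (upperIdx a a) = 1 := by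
  simp [entryVar, upperIdx]

theorem entryVar_of_ne {a b : Fin k} (h : a ≠ b) : entryVar (upperIdx a b) = 1 / 2 := by
  have : min a b ≠ max a b := by simpa using h
  simp [entryVar, upperIdx, this]

/-- The generic symmetric matrix, shifted by `-u`. -/
noncomputable def genericMat (k : ℕ) (u : ℝ) : Matrix (Fin k) (Fin k) (MvPolynomial (UpperIdx k) ℝ) :=
  Matrix.of fun i j => X (upperIdx i j) - if i = j then C u else 0

theorem genericMat_self (u : ℝ) (a : Fin k) :
    genericMat k u a a = X (upperIdx a a) - C u := by
  simp [genericMat]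

theorem genericMat_of_ne (u : ℝ) {a b : Fin k} (h : a ≠ b) :
    genericMat k u a b = X (upperIdx a b) := by
  simp [genericMat, h]

theorem genericMat_transpose (u : ℝ) : (genericMat k u).transpose = genericMat k u := by
  ext1 i j
  simp [genericMat, upperIdx_comm j i, eq_comm]

/-- The polynomials that do not involve the row `a` of the generic symmetric matrix. -/
noncomputable def rowFree (a : Fin k) : Subalgebra ℝ (MvPolynomial (UpperIdx k) ℝ) where
  carrier := {p | ∀ c, pderiv (upperIdx a c) p = 0}
  mul_mem' hp hq c := by simp [hp c, hq c]
  add_mem' hp hq c := by simp [hp c, hq c]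
  algebraMap_mem' r c := by simp [algebraMap_eq]

theorem X_mem_rowFree {a b c : Fin k} (hb : a ≠ b) (hc : a ≠ c) :
    X (upperIdx b c) ∈ rowFree a := by
  intro d
  rw [pderiv_X_of_ne]
  rw [Ne, upperIdx_eq_iff]
  rintro (h | h)
  · exact hb h.1.symm
  · exact hc h.2.symm

theorem genericMat_mem_rowFree (u : ℝ) {a b c : Fin k} (hb : a ≠ b) (hc : a ≠ c) :
    genericMat k u b c ∈ rowFree a := by
  rw [genericMat, Matrix.of_apply]
  refine sub_mem (X_mem_rowFree hb hc) ?_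
  split_ifs
  · exact (rowFree a).algebraMap_mem u
  · exact zero_mem _

/-- Lying in `rowFree a` is the algebraic substitute for independence from row `a`: such factors
behave as constants when that row is integrated out. -/
theorem det_mem_rowFree (u : ℝ) {n : ℕ} {e f : Fin n → Fin k} {a : Fin k}
    (he : ∀ i, a ≠ e i) (hf : ∀ i, a ≠ f i) :
    ((genericMat k u).submatrix e f).det ∈ rowFree a :=
  Matrix.det_mem_of_forall_mem _ fun i j => genericMat_mem_rowFree u (he i) (hf j)

theorem adjugate_mem_rowFree (u : ℝ) {n : ℕ} {e f : Fin n → Fin k} {a : Fin k}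
    (he : ∀ i, a ≠ e i) (hf : ∀ i, a ≠ f i) (i j : Fin n) :
    ((genericMat k u).submatrix e f).adjugate i j ∈ rowFree a :=
  Matrix.adjugate_mem_of_forall_mem _ (fun i j => genericMat_mem_rowFree u (he i) (hf j)) i j

/-- The integration by parts identity of the entries of a `GOE` matrix. -/
def IsStein (E : MvPolynomial (UpperIdx k) ℝ →ₗ[ℝ] ℝ) : Prop :=
  ∀ z p, E (X z * p) = entryVar z * E (pderiv z p)

namespace IsStein

variable {E : MvPolynomial (UpperIdx k) ℝ →ₗ[ℝ] ℝ} {a : Fin k}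
  {q : MvPolynomial (UpperIdx k) ℝ}

theorem pderiv_X_row (a c d : Fin k) :
    pderiv (upperIdx a c) (X (upperIdx a d) : MvPolynomial (UpperIdx k) ℝ) =
      if c = d then 1 else 0 := by
  classical
  rw [pderiv_X, Pi.single_apply]
  refine if_congr ?_ rfl rfl
  rw [upperIdx_eq_iff]
  constructor
  · rintro (h | h)
    · exact h.2.symm
    · rw [← h.1, h.2]
  · rintro rfl
    exact Or.inl ⟨rfl, rfl⟩

theorem row_one (hE : IsStein E) (hq : q ∈ rowFree a) (c : Fin k) : E (X (upperIdx a c) * q) = 0 := by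
  rw [hE, hq c, map_zero, mul_zero]

theorem row_two (hE : IsStein E) (hq : q ∈ rowFree a) (c d : Fin k) :
    E (X (upperIdx a c) * (X (upperIdx a d) * q)) =
      if c = d then entryVar (upperIdx a c) * E q else 0 := by
  rw [hE, Derivation.leibniz, hq c, smul_zero, zero_add, pderiv_X_row, smul_eq_mul]
  split_ifs <;> simp

theorem row_three (hE : IsStein E) (hq : q ∈ rowFree a) (b c d : Fin k) :
    E (X (upperIdx a b) * (X (upperIdx a c) * (X (upperIdx a d) * q))) = 0 := by
  rw [hE]
  simp only [Derivation.leibniz, hq b, pderiv_X_row, smul_eq_mul]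
  split_ifs <;> simp [hE.row_one hq]

/-- Wick's formula: one term for each of the three pairings of four Gaussian factors. -/
theorem row_four (hE : IsStein E) (hq : q ∈ rowFree a) (b c d e : Fin k) :
    E (X (upperIdx a b) * (X (upperIdx a c) * (X (upperIdx a d) * (X (upperIdx a e) * q)))) =
      entryVar (upperIdx a b) * entryVar (upperIdx a d) *
          (if b = c then if d = e then E q else 0 else 0) +
      entryVar (upperIdx a b) * entryVar (upperIdx a c) *
          (if b = d then if c = e then E q else 0 else 0) +
      entryVar (upperIdx a b) * entryVar (upperIdx a c) *
          (if b = e then if c = d then E q else 0 else 0) := by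
  rw [hE]
  simp only [Derivation.leibniz, hq b, pderiv_X_row, smul_eq_mul, mul_add,
    map_add]
  split_ifs <;> subst_vars <;> simp_all [hE.row_two hq] <;> ring

end IsStein

end GOEMoment

/-! ### Integrating out the bordering row. -/

namespace GOEMoment

open MvPolynomial

variable {k : ℕ}

/-- The principal submatrix, on the rows `e`, of the shifted generic symmetric matrix. -/
noncomputable abbrev prinMat (u : ℝ) {n : ℕ} (e : Fin n → Fin k) :
    Matrix (Fin n) (Fin n) (MvPolynomial (UpperIdx k) ℝ) :=
  (genericMat k u).submatrix e e

theorem map_sq_sum_sum {A B ι : Type*} [CommRing A] [AddCommMonoid B] [Fintype ι]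
    (E : A →+ B) (T : ι → ι → A) :
    E ((∑ i, ∑ j, T i j) ^ 2) = ∑ i, ∑ j, ∑ l, ∑ m, E (T i j * T l m) := by
  rw [sq, Finset.sum_mul, map_sum]
  refine Finset.sum_congr rfl fun i _ => ?_
  rw [Finset.sum_mul, map_sum]
  refine Finset.sum_congr rfl fun j _ => ?_
  simp only [Finset.mul_sum, map_sum]

theorem adjugate_prinMat_comm (u : ℝ) {n : ℕ} (e : Fin n → Fin k) (i j : Fin n) :
    (prinMat u e).adjugate i j = (prinMat u e).adjugate j i := by
  have h : (prinMat u e).transpose = prinMat u e := by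
    rw [prinMat, Matrix.transpose_submatrix, genericMat_transpose]
  conv_lhs => rw [← h, ← Matrix.adjugate_transpose, Matrix.transpose_apply]

theorem det_bordered_self (u : ℝ) {n : ℕ} {e : Fin n → Fin k} {a : Fin k} (ha : ∀ i, a ≠ e i) :
    (prinMat u (Fin.cons a e : Fin (n + 1) → Fin k)).det =
      (X (upperIdx a a) - C u) * (prinMat u e).det -
        ∑ i, ∑ j, X (upperIdx a (e i)) * X (upperIdx a (e j)) * (prinMat u e).adjugate i j := by
  rw [Matrix.det_succ_eq_sub_sum_adjugate]
  have h : (prinMat u (Fin.cons a e : Fin (n + 1) → Fin k)).submatrix Fin.succ Fin.succ =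
      prinMat u e := by
    ext1 i j
    simp
  rw [h]
  simp only [Matrix.submatrix_apply, Fin.cons_zero, Fin.cons_succ, genericMat_self,
    genericMat_of_ne u (ha _), genericMat_of_ne u (ha _).symm, upperIdx_comm (e _) a]

theorem det_bordered_of_ne (u : ℝ) {n : ℕ} {e : Fin n → Fin k} {a b : Fin k}
    (ha : ∀ i, a ≠ e i) (hb : ∀ i, b ≠ e i) (hab : a ≠ b) :
    ((genericMat k u).submatrix (Fin.cons a e : Fin (n + 1) → Fin k)
        (Fin.cons b e : Fin (n + 1) → Fin k)).det =
      X (upperIdx a b) * (prinMat u e).det -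
        ∑ i, ∑ j, X (upperIdx a (e i)) * X (upperIdx b (e j)) * (prinMat u e).adjugate i j := by
  rw [Matrix.det_succ_eq_sub_sum_adjugate]
  have h : ((genericMat k u).submatrix (Fin.cons a e : Fin (n + 1) → Fin k)
      (Fin.cons b e : Fin (n + 1) → Fin k)).submatrix Fin.succ Fin.succ = prinMat u e := by
    ext1 i j
    simp
  rw [h]
  simp only [Matrix.submatrix_apply, Fin.cons_zero, Fin.cons_succ, genericMat_of_ne u hab,
    genericMat_of_ne u (ha _), genericMat_of_ne u (hb _).symm, upperIdx_comm (e _) b]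

namespace IsStein

variable {E : MvPolynomial (UpperIdx k) ℝ →ₗ[ℝ] ℝ} {n : ℕ} {e : Fin n → Fin k} {a b : Fin k}

/-- Only the mean `-u` of the corner and the diagonal part of the quadratic form survive; the latter
has weight 1/2, the variance of an off-diagonal entry. -/
theorem bordered_mul (hE : IsStein E) (u : ℝ) (he : Function.Injective e) (ha : ∀ i, a ≠ e i)
    {q : MvPolynomial (UpperIdx k) ℝ} (hq : q ∈ rowFree a) :
    E ((prinMat u (Fin.cons a e : Fin (n + 1) → Fin k)).det * q) =
      -u * E ((prinMat u e).det * q) - 1 / 2 * E ((prinMat u e).adjugate.trace * q) := by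
  have hd := det_mem_rowFree u ha ha
  have hS := adjugate_mem_rowFree u ha ha
  rw [det_bordered_self u ha, sub_mul, sub_mul, sub_mul, map_sub, map_sub, mul_assoc,
    hE.row_one (mul_mem hd hq), mul_assoc, ← smul_eq_C_mul, map_smul, Finset.sum_mul, map_sum]
  have : ∀ i j, E (X (upperIdx a (e i)) * X (upperIdx a (e j)) *
      (prinMat u e).adjugate i j * q) =
        if i = j then 1 / 2 * E ((prinMat u e).adjugate i i * q) else 0 := by
    intro i j
    rw [mul_assoc, mul_assoc, hE.row_two (mul_mem (hS i j) hq), entryVar_of_ne (ha i)]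
    simp only [he.eq_iff]
    split_ifs with h
    · rw [h]
    · rfl
  simp only [Finset.sum_mul, map_sum, this, Finset.sum_ite_eq, Finset.mem_univ, if_true,
    Matrix.trace, Matrix.diag_apply, Finset.mul_sum, smul_eq_mul]
  ring

/-- The corner contributes its second moment `1 + u²`. In the square of the quadratic form the three
pairings give `(tr S)²` once and, as `S` is symmetric, `tr S²` twice, each with weight `(1/2)²`. -/
theorem bordered_sq (hE : IsStein E) (u : ℝ) (he : Function.Injective e) (ha : ∀ i, a ≠ e i) :
    E ((prinMat u (Fin.cons a e : Fin (n + 1) → Fin k)).det ^ 2) =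
      (1 + u ^ 2) * E ((prinMat u e).det ^ 2) +
        u * E ((prinMat u e).det * (prinMat u e).adjugate.trace) +
        1 / 4 * (E ((prinMat u e).adjugate.trace ^ 2) +
          2 * E (∑ i, ∑ j, (prinMat u e).adjugate i j ^ 2)) := by
  have hd := det_mem_rowFree u ha ha
  have hS := adjugate_mem_rowFree u ha ha
  have hsymm := adjugate_prinMat_comm u e
  set d := (prinMat u e).det
  set S := (prinMat u e).adjugate
  have h1 : E (((X (upperIdx a a) - C u) * d) ^ 2) = (1 + u ^ 2) * E (d ^ 2) := by
    have : ((X (upperIdx a a) - C u) * d) ^ 2 =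
        X (upperIdx a a) * (X (upperIdx a a) * d ^ 2) - C (2 * u) * (X (upperIdx a a) * d ^ 2) +
          C (u ^ 2) * d ^ 2 := by
      simp only [C_mul, C_pow, map_ofNat]
      ring
    rw [this, map_add, map_sub, ← smul_eq_C_mul, ← smul_eq_C_mul, map_smul, map_smul,
      hE.row_one (pow_mem hd 2), hE.row_two (pow_mem hd 2), entryVar_self, smul_eq_mul,
      smul_eq_mul, if_pos rfl]
    ring
  have h2 : ∀ i j, E (((X (upperIdx a a) - C u) * d) *
      (X (upperIdx a (e i)) * X (upperIdx a (e j)) * S i j)) =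
        if i = j then -u / 2 * E (d * S i i) else 0 := by
    intro i j
    have hdS := mul_mem hd (hS i j)
    have : ((X (upperIdx a a) - C u) * d) *
        (X (upperIdx a (e i)) * X (upperIdx a (e j)) * S i j) =
        X (upperIdx a a) * (X (upperIdx a (e i)) * (X (upperIdx a (e j)) * (d * S i j))) -
          C u * (X (upperIdx a (e i)) * (X (upperIdx a (e j)) * (d * S i j))) := by
      ring
    rw [this, map_sub, ← smul_eq_C_mul, map_smul, hE.row_three hdS, hE.row_two hdS,
      entryVar_of_ne (ha i), smul_eq_mul]
    simp only [he.eq_iff]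
    split_ifs with h
    · rw [h]; ring
    · ring
  have h3 : ∀ i j l m, E ((X (upperIdx a (e i)) * X (upperIdx a (e j)) * S i j) *
      (X (upperIdx a (e l)) * X (upperIdx a (e m)) * S l m)) =
        1 / 4 * (if i = j then if l = m then E (S i j * S l m) else 0 else 0) +
        1 / 4 * (if i = l then if j = m then E (S i j * S l m) else 0 else 0) +
        1 / 4 * (if i = m then if j = l then E (S i j * S l m) else 0 else 0) := by
    intro i j l m
    have : (X (upperIdx a (e i)) * X (upperIdx a (e j)) * S i j) *
      (X (upperIdx a (e l)) * X (upperIdx a (e m)) * S l m) =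
        X (upperIdx a (e i)) * (X (upperIdx a (e j)) * (X (upperIdx a (e l)) *
          (X (upperIdx a (e m)) * (S i j * S l m)))) := by
      ring
    rw [this, hE.row_four (mul_mem (hS i j) (hS l m))]
    simp only [he.eq_iff, entryVar_of_ne (ha _)]
    norm_num
  have h4 : E ((∑ i, ∑ j, X (upperIdx a (e i)) * X (upperIdx a (e j)) * S i j) ^ 2) =
      1 / 4 * (E (S.trace ^ 2) + 2 * E (∑ i, ∑ j, S i j ^ 2)) := by
    have ht : E (S.trace ^ 2) = ∑ i, ∑ l, E (S i i * S l l) := by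
      simp only [Matrix.trace, Matrix.diag_apply, sq, Finset.sum_mul_sum, map_sum]
    refine (map_sq_sum_sum E.toAddMonoidHom _).trans ?_
    simp only [LinearMap.toAddMonoidHom_coe, h3, Finset.sum_add_distrib, ← Finset.mul_sum,
      Finset.sum_ite_eq, Finset.mem_univ, if_true, Finset.sum_ite_irrel, Finset.sum_const_zero]
    have hs : ∀ i j, E (S i j * S j i) = E (S i j ^ 2) := fun i j => by rw [hsymm j i, sq]
    simp only [ht, hs, map_sum, ← sq]
    ring
  have h5 : E (((X (upperIdx a a) - C u) * d) *
      ∑ i, ∑ j, X (upperIdx a (e i)) * X (upperIdx a (e j)) * S i j) =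
        -u / 2 * E (d * S.trace) := by
    rw [Matrix.trace]
    simp only [Finset.mul_sum, map_sum, h2, Finset.sum_ite_eq, Finset.mem_univ, if_true,
      Matrix.diag_apply]
  rw [det_bordered_self u ha, sub_sq, map_add, map_sub, h1, h4, mul_assoc 2, two_mul, map_add, h5]
  ring

/-- The minor bordered by `b` does not involve row `a`, so `bordered_mul` integrates out row `a`
first and then row `b`. -/
theorem bordered_mul_bordered (hE : IsStein E) (u : ℝ) (he : Function.Injective e)
    (ha : ∀ i, a ≠ e i) (hb : ∀ i, b ≠ e i) (hab : a ≠ b) :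
    E ((prinMat u (Fin.cons a e : Fin (n + 1) → Fin k)).det *
        (prinMat u (Fin.cons b e : Fin (n + 1) → Fin k)).det) =
      u ^ 2 * E ((prinMat u e).det ^ 2) +
        u * E ((prinMat u e).det * (prinMat u e).adjugate.trace) +
        1 / 4 * E ((prinMat u e).adjugate.trace ^ 2) := by
  have hab' : ∀ i, a ≠ (Fin.cons b e : Fin (n + 1) → Fin k) i := Fin.cases hab ha
  have hd := det_mem_rowFree u hb hb
  have ht : (prinMat u e).adjugate.trace ∈ rowFree b :=
    sum_mem fun i _ => adjugate_mem_rowFree u hb hb i i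
  rw [hE.bordered_mul u he ha (det_mem_rowFree u hab' hab'), mul_comm (Matrix.det _), hE.bordered_mul u he hb hd,
    mul_comm (Matrix.trace _) (Matrix.det (prinMat u (Fin.cons b e))), hE.bordered_mul u he hb ht, ← sq, ← sq,
    mul_comm (Matrix.trace _) (Matrix.det _)]
  ring

theorem bordered_of_ne_sq (hE : IsStein E) (u : ℝ) (he : Function.Injective e)
    (ha : ∀ i, a ≠ e i) (hb : ∀ i, b ≠ e i) (hab : a ≠ b) :
    E (((genericMat k u).submatrix (Fin.cons a e : Fin (n + 1) → Fin k)
        (Fin.cons b e : Fin (n + 1) → Fin k)).det ^ 2) =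
      1 / 2 * E ((prinMat u e).det ^ 2) +
        1 / 4 * E (∑ i, ∑ j, (prinMat u e).adjugate i j ^ 2) := by
  have hd := det_mem_rowFree u ha ha
  have hS := adjugate_mem_rowFree u ha ha
  have hS' := adjugate_mem_rowFree u hb hb
  -- The entries joining `b` to `e` count as constants while row `a` is integrated out; row `b`
  -- follows.
  have hX : ∀ j, X (upperIdx b (e j)) ∈ rowFree a := fun j => X_mem_rowFree hab (ha j)
  rw [det_bordered_of_ne u ha hb hab]
  set d := (prinMat u e).det
  set S := (prinMat u e).adjugate
  have h1 : E ((X (upperIdx a b) * d) ^ 2) = 1 / 2 * E (d ^ 2) := by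
    have : (X (upperIdx a b) * d) ^ 2 = X (upperIdx a b) * (X (upperIdx a b) * d ^ 2) := by ring
    rw [this, hE.row_two (pow_mem hd 2), if_pos rfl, entryVar_of_ne hab]
  have h2 : ∀ i j, E ((X (upperIdx a b) * d) *
      (X (upperIdx a (e i)) * X (upperIdx b (e j)) * S i j)) = 0 := by
    intro i j
    have : (X (upperIdx a b) * d) * (X (upperIdx a (e i)) * X (upperIdx b (e j)) * S i j) =
        X (upperIdx a b) * (X (upperIdx a (e i)) * (X (upperIdx b (e j)) * (d * S i j))) := by
      ring
    rw [this, hE.row_two (mul_mem (hX j) (mul_mem hd (hS i j))), if_neg (hb i)]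
  have h3 : ∀ i j l m, E ((X (upperIdx a (e i)) * X (upperIdx b (e j)) * S i j) *
      (X (upperIdx a (e l)) * X (upperIdx b (e m)) * S l m)) =
        if i = l then if j = m then 1 / 4 * E (S i j ^ 2) else 0 else 0 := by
    intro i j l m
    have : (X (upperIdx a (e i)) * X (upperIdx b (e j)) * S i j) *
      (X (upperIdx a (e l)) * X (upperIdx b (e m)) * S l m) =
        X (upperIdx a (e i)) * (X (upperIdx a (e l)) * (X (upperIdx b (e j)) *
          (X (upperIdx b (e m)) * (S i j * S l m)))) := by
      ring
    rw [this, hE.row_two (mul_mem (hX j) (mul_mem (hX m) (mul_mem (hS i j) (hS l m)))),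
      hE.row_two (mul_mem (hS' i j) (hS' l m))]
    simp only [he.eq_iff, entryVar_of_ne (ha _), entryVar_of_ne (hb _)]
    split_ifs with hil hjm
    · subst hil hjm
      rw [sq]; ring
    · ring
    · rfl
  have h4 : E ((∑ i, ∑ j, X (upperIdx a (e i)) * X (upperIdx b (e j)) * S i j) ^ 2) =
      1 / 4 * E (∑ i, ∑ j, S i j ^ 2) := by
    refine (map_sq_sum_sum E.toAddMonoidHom _).trans ?_
    simp only [LinearMap.toAddMonoidHom_coe, h3, Finset.sum_ite_eq, Finset.mem_univ, if_true,
      Finset.sum_ite_irrel, Finset.sum_const_zero, map_sum, Finset.mul_sum]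
  rw [sub_sq, map_add, map_sub, h1, h4, mul_assoc 2, two_mul, map_add]
  simp only [Finset.mul_sum, map_sum, h2, Finset.sum_const_zero, add_zero, sub_zero]

end IsStein

end GOEMoment

/-! ### The closed recursion for the four second moments. -/

namespace GOEMoment

open MvPolynomial

/-- The monic Hermite polynomials `2⁻ⁿ Hₙ(u)`. -/
noncomputable def monicHermite (u : ℝ) : ℕ → ℝ
  | 0 => 1
  | 1 => u
  | n + 2 => u * monicHermite u (n + 1) - (n + 1) / 2 * monicHermite u n

theorem monicHermite_add_two (u : ℝ) (n : ℕ) :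
    monicHermite u (n + 2) = u * monicHermite u (n + 1) - (n + 1) / 2 * monicHermite u n := rfl

/-- The value of `𝔼 det(Q - u)²` for `Q ∼ GOE(n)`, in terms of Hermite polynomials. -/
noncomputable def detSqMoment (u : ℝ) (n : ℕ) : ℝ :=
  let x := monicHermite u (n + 1)
  let y := monicHermite u n
  ((4 * n + 8 - 2 * u ^ 2) * x ^ 2 + (2 * u ^ 3 - 7 * u - 4 * n * u) * x * y +
    ((n + 1) * (1 - u ^ 2) + 2 * (n + 1) ^ 2) * y ^ 2) / 3

/-- The polynomial expression of `n * detSqMoment u (n - 1)`. -/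
noncomputable def mulPrevDetSqMoment (u : ℝ) (n : ℕ) : ℝ :=
  let y := monicHermite u n
  -- By the three-term recurrence this is `n * monicHermite u (n - 1)`, the derivative of `y`;
  -- written so, it needs no truncated subtraction and vanishes at `n = 0`.
  let z := 2 * (u * y - monicHermite u (n + 1))
  ((4 * n ^ 2 + 4 * n - 2 * n * u ^ 2) * y ^ 2 + (2 * u ^ 3 - 3 * u - 4 * n * u) * y * z +
    (1 - u ^ 2 + 2 * n) * z ^ 2) / 3

/-- The value of `𝔼 det(Q - u) tr adj(Q - u)` for `Q ∼ GOE(n)`. -/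
noncomputable def detMulTraceMoment (u : ℝ) (n : ℕ) : ℝ :=
  let y := monicHermite u n
  let z := 2 * (u * y - monicHermite u (n + 1))
  (u ^ 2 / 2 - 1 / 4) * y * z - u / 2 * mulPrevDetSqMoment u n - n * u / 2 * y ^ 2 - u / 4 * z ^ 2

/-- The value of `𝔼 (tr adj(Q - u))²` for `Q ∼ GOE(n)`. -/
noncomputable def traceSqMoment (u : ℝ) (n : ℕ) : ℝ :=
  let y := monicHermite u n
  let z := 2 * (u * y - monicHermite u (n + 1))
  (3 / 5 + 2 / 5 * u ^ 2 + n / 5) * mulPrevDetSqMoment u n - 2 / 5 * u * y * z + z ^ 2 / 5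

/-- The value of `𝔼 tr (adj(Q - u)²)` for `Q ∼ GOE(n)`. -/
noncomputable def normSqMoment (u : ℝ) (n : ℕ) : ℝ :=
  let y := monicHermite u n
  let z := 2 * (u * y - monicHermite u (n + 1))
  (7 / 10 - u ^ 2 / 5 + 2 * n / 5) * mulPrevDetSqMoment u n + 1 / 5 * u * y * z - z ^ 2 / 10

theorem detSqMoment_zero (u : ℝ) : detSqMoment u 0 = 1 := by
  simp only [detSqMoment, monicHermite]; push_cast; ring

theorem detMulTraceMoment_zero (u : ℝ) : detMulTraceMoment u 0 = 0 := by
  simp only [detMulTraceMoment, mulPrevDetSqMoment, monicHermite]; push_cast; ring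

theorem traceSqMoment_zero (u : ℝ) : traceSqMoment u 0 = 0 := by
  simp only [traceSqMoment, mulPrevDetSqMoment, monicHermite]; push_cast; ring

theorem normSqMoment_zero (u : ℝ) : normSqMoment u 0 = 0 := by
  simp only [normSqMoment, mulPrevDetSqMoment, monicHermite]; push_cast; ring

theorem traceSqMoment_one (u : ℝ) : traceSqMoment u 1 = 1 := by
  simp only [traceSqMoment, mulPrevDetSqMoment, monicHermite]; push_cast; ring

theorem normSqMoment_one (u : ℝ) : normSqMoment u 1 = 1 := by
  simp only [normSqMoment, mulPrevDetSqMoment, monicHermite]; push_cast; ring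

/-- This and the next three identities say that the closed forms obey the recursion of the moments.
Once the recurrence reduces everything to two consecutive Hermite polynomials, each is a polynomial
identity. -/
theorem detSqMoment_succ (u : ℝ) (n : ℕ) :
    detSqMoment u (n + 1) = (1 + u ^ 2) * detSqMoment u n + u * detMulTraceMoment u n +
      1 / 4 * (traceSqMoment u n + 2 * normSqMoment u n) := by
  simp only [detSqMoment, detMulTraceMoment, traceSqMoment, normSqMoment, mulPrevDetSqMoment,
    monicHermite_add_two]
  push_cast
  ring

theorem detMulTraceMoment_succ (u : ℝ) (n : ℕ) :
    detMulTraceMoment u (n + 1) =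
      (n + 1) * (-u * detSqMoment u n - 1 / 2 * detMulTraceMoment u n) := by
  simp only [detSqMoment, detMulTraceMoment, mulPrevDetSqMoment, monicHermite_add_two]
  push_cast
  ring

theorem traceSqMoment_add_two (u : ℝ) (n : ℕ) :
    traceSqMoment u (n + 2) = (n + 2) * detSqMoment u (n + 1) + (n + 2) * (n + 1) *
      (u ^ 2 * detSqMoment u n + u * detMulTraceMoment u n + 1 / 4 * traceSqMoment u n) := by
  simp only [detSqMoment, detMulTraceMoment, traceSqMoment, mulPrevDetSqMoment,
    monicHermite_add_two]
  push_cast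
  ring

theorem normSqMoment_add_two (u : ℝ) (n : ℕ) :
    normSqMoment u (n + 2) = (n + 2) * detSqMoment u (n + 1) + (n + 2) * (n + 1) *
      (1 / 2 * detSqMoment u n + 1 / 4 * normSqMoment u n) := by
  simp only [detSqMoment, normSqMoment, mulPrevDetSqMoment, monicHermite_add_two]
  push_cast
  ring

theorem exists_perm_zero {n : ℕ} (i : Fin (n + 1)) : ∃ σ : Equiv.Perm (Fin (n + 1)), σ 0 = i :=
  ⟨Equiv.swap 0 i, Equiv.swap_apply_left _ _⟩

theorem exists_perm_zero_one {n : ℕ} {i j : Fin (n + 2)} (h : i ≠ j) :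
    ∃ σ : Equiv.Perm (Fin (n + 2)), σ 0 = i ∧ σ 1 = j := by
  have hj : Equiv.swap 0 i j ≠ 0 := by
    rw [Ne, Equiv.swap_apply_eq_iff, Equiv.swap_apply_left]
    exact h.symm
  refine ⟨(Equiv.swap 1 (Equiv.swap 0 i j)).trans (Equiv.swap 0 i), ?_, ?_⟩
  · rw [Equiv.trans_apply, Equiv.swap_apply_of_ne_of_ne (by simp) hj.symm, Equiv.swap_apply_left]
  · rw [Equiv.trans_apply, Equiv.swap_apply_left, Equiv.swap_apply_self]

variable {k n : ℕ}

/-- Relabelling the rows reduces every diagonal cofactor to position `(0, 0)` and every pair of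
distinct indices to `(0, 1)`. -/
theorem det_prinMat_comp (u : ℝ) (e : Fin n → Fin k) (σ : Equiv.Perm (Fin n)) :
    (prinMat u (e ∘ σ)).det = (prinMat u e).det := by
  rw [prinMat, ← Matrix.submatrix_submatrix, Matrix.det_submatrix_equiv_self]

theorem adjugate_prinMat_comp (u : ℝ) (e : Fin n → Fin k) (σ : Equiv.Perm (Fin n)) (i j : Fin n) :
    (prinMat u (e ∘ σ)).adjugate i j = (prinMat u e).adjugate (σ i) (σ j) := by
  rw [prinMat, ← Matrix.submatrix_submatrix, Matrix.adjugate_submatrix_equiv_self,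
    Matrix.submatrix_apply]

theorem adjugate_prinMat_zero_zero (u : ℝ) (e : Fin (n + 1) → Fin k) :
    (prinMat u e).adjugate 0 0 = (prinMat u (Fin.tail e)).det := by
  rw [Matrix.adjugate_fin_succ_eq_det_submatrix]
  simp only [Fin.val_zero, add_zero, pow_zero, one_mul, Fin.succAbove_zero,
    Matrix.submatrix_submatrix]
  rfl

theorem succAbove_one_comp (e : Fin (n + 2) → Fin k) :
    e ∘ Fin.succAbove 1 = Fin.cons (e 0) (Fin.tail (Fin.tail e)) := by
  funext i
  refine Fin.cases ?_ (fun i => ?_) i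
  · simp
  · have : (1 : Fin (n + 2)).succAbove i.succ = i.succ.succ := by
      rw [← Fin.succ_zero_eq_one, Fin.succ_succAbove_succ, Fin.succAbove_zero]
    simp [this, Fin.tail]

theorem succAbove_zero_comp (e : Fin (n + 2) → Fin k) :
    e ∘ Fin.succAbove 0 = Fin.cons (e 1) (Fin.tail (Fin.tail e)) := by
  funext i
  refine Fin.cases ?_ (fun i => ?_) i <;> simp [Fin.tail]

theorem adjugate_prinMat_one_one (u : ℝ) (e : Fin (n + 2) → Fin k) :
    (prinMat u e).adjugate 1 1 =
      (prinMat u (Fin.cons (e 0) (Fin.tail (Fin.tail e)) : Fin (n + 1) → Fin k)).det := by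
  rw [Matrix.adjugate_fin_succ_eq_det_submatrix, Matrix.submatrix_submatrix, succAbove_one_comp]
  simp

/-- Squaring removes the cofactor sign. -/
theorem adjugate_prinMat_zero_one_sq (u : ℝ) (e : Fin (n + 2) → Fin k) :
    (prinMat u e).adjugate 0 1 ^ 2 =
      ((genericMat k u).submatrix
        (Fin.cons (e 0) (Fin.tail (Fin.tail e)) : Fin (n + 1) → Fin k)
        (Fin.cons (e 1) (Fin.tail (Fin.tail e)) : Fin (n + 1) → Fin k)).det ^ 2 := by
  rw [Matrix.adjugate_fin_succ_eq_det_submatrix, Matrix.submatrix_submatrix, succAbove_one_comp,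
    succAbove_zero_comp]
  simp

/-- The second moments of the principal submatrices on `n` rows have the expected values. -/
structure HasMoments (E : MvPolynomial (UpperIdx k) ℝ →ₗ[ℝ] ℝ) (u : ℝ) (e : Fin n → Fin k) :
    Prop where
  detSq : E ((prinMat u e).det ^ 2) = detSqMoment u n
  detMulTrace : E ((prinMat u e).det * (prinMat u e).adjugate.trace) = detMulTraceMoment u n
  traceSq : E ((prinMat u e).adjugate.trace ^ 2) = traceSqMoment u n
  normSq : E (∑ i, ∑ j, (prinMat u e).adjugate i j ^ 2) = normSqMoment u n

theorem sum_sum_eq_of_diag_of_offDiag {c d : ℝ} {f : Fin (n + 1) → Fin (n + 1) → ℝ}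
    (h : ∀ i, f i i = c) (h' : ∀ i j, i ≠ j → f i j = d) :
    ∑ i, ∑ j, f i j = (n + 1) * c + (n + 1) * n * d := by
  have : ∀ i, ∑ j, f i j = c + n * d := by
    intro i
    rw [Fin.sum_univ_succAbove _ i, h, Finset.sum_congr rfl fun j _ =>
      h' i _ (Fin.succAbove_ne i j).symm]
    simp
  simp only [this, Finset.sum_const, Finset.card_univ, Fintype.card_fin, nsmul_eq_mul]
  push_cast
  ring

namespace IsStein

variable {E : MvPolynomial (UpperIdx k) ℝ →ₗ[ℝ] ℝ}

theorem detSq_eq (hE : IsStein E) (u : ℝ)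
    (ih : ∀ e : Fin n → Fin k, Function.Injective e → HasMoments E u e)
    {e : Fin (n + 1) → Fin k} (he : Function.Injective e) :
    E ((prinMat u e).det ^ 2) = detSqMoment u (n + 1) := by
  obtain ⟨a, e, rfl⟩ : ∃ a e', e = Fin.cons a e' := ⟨e 0, Fin.tail e, (Fin.cons_self_tail e).symm⟩
  rw [Fin.cons_injective_iff] at he
  have h := ih e he.2
  rw [hE.bordered_sq u he.2 (fun i hi => he.1 ⟨i, hi.symm⟩), h.detSq, h.detMulTrace, h.traceSq,
    h.normSq, detSqMoment_succ]

theorem detMulTrace_eq (hE : IsStein E) (u : ℝ)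
    (ih : ∀ e : Fin n → Fin k, Function.Injective e → HasMoments E u e)
    {e : Fin (n + 1) → Fin k} (he : Function.Injective e) :
    E ((prinMat u e).det * (prinMat u e).adjugate.trace) = detMulTraceMoment u (n + 1) := by
  have key : ∀ i, E ((prinMat u e).det * (prinMat u e).adjugate i i) =
      -u * detSqMoment u n - 1 / 2 * detMulTraceMoment u n := by
    intro i
    obtain ⟨σ, rfl⟩ := exists_perm_zero i
    rw [← adjugate_prinMat_comp, ← det_prinMat_comp u e σ, adjugate_prinMat_zero_zero]
    have he' := he.comp σ.injective
    generalize e ∘ σ = f at he'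
    obtain ⟨a, f, rfl⟩ : ∃ a f', f = Fin.cons a f' :=
      ⟨f 0, Fin.tail f, (Fin.cons_self_tail f).symm⟩
    rw [Fin.cons_injective_iff] at he'
    have ha : ∀ i, a ≠ f i := fun i hi => he'.1 ⟨i, hi.symm⟩
    have h := ih f he'.2
    rw [Fin.tail_cons, hE.bordered_mul u he'.2 ha (det_mem_rowFree u ha ha), ← sq, h.detSq,
      mul_comm (Matrix.trace _), h.detMulTrace]
  simp only [Matrix.trace, Matrix.diag_apply, Finset.mul_sum, map_sum, key, Finset.sum_const,
    Finset.card_univ, Fintype.card_fin, nsmul_eq_mul, detMulTraceMoment_succ]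
  push_cast
  ring

theorem adjugate_diag_sq_eq (u : ℝ)
    (ih : ∀ e : Fin n → Fin k, Function.Injective e → HasMoments E u e)
    {e : Fin (n + 1) → Fin k} (he : Function.Injective e) (i : Fin (n + 1)) :
    E ((prinMat u e).adjugate i i ^ 2) = detSqMoment u n := by
  obtain ⟨σ, rfl⟩ := exists_perm_zero i
  rw [← adjugate_prinMat_comp, adjugate_prinMat_zero_zero]
  exact (ih _ ((he.comp σ.injective).comp (Fin.succ_injective _))).detSq

theorem exists_cons_cons {e : Fin (n + 2) → Fin k} (he : Function.Injective e) :
    ∃ a b f, e = Fin.cons a (Fin.cons b f : Fin (n + 1) → Fin k) ∧ Function.Injective f ∧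
      (∀ i, a ≠ f i) ∧ (∀ i, b ≠ f i) ∧ a ≠ b := by
  refine ⟨e 0, e 1, Fin.tail (Fin.tail e), ?_, ?_, ?_, ?_, ?_⟩
  · rw [← succAbove_zero_comp]
    funext i
    refine Fin.cases ?_ (fun i => ?_) i <;> simp
  · exact (he.comp (Fin.succ_injective _)).comp (Fin.succ_injective _)
  · intro i h
    exact absurd (he h) (Fin.succ_ne_zero _).symm
  · intro i h
    rw [← Fin.succ_zero_eq_one] at h
    exact absurd (Fin.succ_injective _ (he h)) (Fin.succ_ne_zero _).symm
  · intro h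
    exact absurd (he h) (by simp)

theorem adjugate_diag_mul_diag_eq (hE : IsStein E) (u : ℝ)
    (ih : ∀ e : Fin n → Fin k, Function.Injective e → HasMoments E u e)
    {e : Fin (n + 2) → Fin k} (he : Function.Injective e) {i j : Fin (n + 2)} (hij : i ≠ j) :
    E ((prinMat u e).adjugate i i * (prinMat u e).adjugate j j) =
      u ^ 2 * detSqMoment u n + u * detMulTraceMoment u n + 1 / 4 * traceSqMoment u n := by
  obtain ⟨σ, rfl, rfl⟩ := exists_perm_zero_one hij
  rw [← adjugate_prinMat_comp, ← adjugate_prinMat_comp]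
  obtain ⟨a, b, f, hf, hfi, ha, hb, hab⟩ := exists_cons_cons (he.comp σ.injective)
  have h := ih f hfi
  -- Deleting index 0 leaves `b` as the border of `f`, and deleting index 1 leaves `a`; hence the
  -- exchanged roles of `a` and `b`.
  rw [hf, adjugate_prinMat_zero_zero, adjugate_prinMat_one_one, Fin.tail_cons, Fin.tail_cons,
    Fin.cons_zero, hE.bordered_mul_bordered u hfi hb ha hab.symm, h.detSq, h.detMulTrace,
    h.traceSq]

theorem adjugate_offDiag_sq_eq (hE : IsStein E) (u : ℝ)
    (ih : ∀ e : Fin n → Fin k, Function.Injective e → HasMoments E u e)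
    {e : Fin (n + 2) → Fin k} (he : Function.Injective e) {i j : Fin (n + 2)} (hij : i ≠ j) :
    E ((prinMat u e).adjugate i j ^ 2) =
      1 / 2 * detSqMoment u n + 1 / 4 * normSqMoment u n := by
  obtain ⟨σ, rfl, rfl⟩ := exists_perm_zero_one hij
  rw [← adjugate_prinMat_comp]
  obtain ⟨a, b, f, hf, hfi, ha, hb, hab⟩ := exists_cons_cons (he.comp σ.injective)
  have h := ih f hfi
  have h1 : (Fin.cons a (Fin.cons b f : Fin (n + 1) → Fin k) : Fin (n + 2) → Fin k) 1 = b := rfl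
  rw [hf, adjugate_prinMat_zero_one_sq, Fin.tail_cons, Fin.tail_cons,
    Fin.cons_zero, h1, hE.bordered_of_ne_sq u hfi ha hb hab, h.detSq, h.normSq]

theorem hasMoments_zero (h1 : E 1 = 1) (u : ℝ) (e : Fin 0 → Fin k) : HasMoments E u e := by
  constructor
  · simp [h1, detSqMoment_zero]
  · simp [Matrix.trace, detMulTraceMoment_zero]
  · simp [Matrix.trace, traceSqMoment_zero]
  · simp [normSqMoment_zero]

/-- The induction takes two steps because products of cofactors at size `n + 2` are doubly bordered
minors over `n` common rows. Letting `e` range over all injections keeps a single `E` for every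
size. -/
theorem hasMoments (hE : IsStein E) (h1 : E 1 = 1) (u : ℝ) :
    ∀ (n : ℕ) (e : Fin n → Fin k), Function.Injective e → HasMoments E u e := by
  intro n
  induction n using Nat.twoStepInduction with
  | zero => exact fun e _ => hasMoments_zero h1 u e
  | one =>
    intro e he
    have ih := fun (e : Fin 0 → Fin k) (_ : Function.Injective e) => hasMoments_zero h1 u e
    refine ⟨hE.detSq_eq u ih he, hE.detMulTrace_eq u ih he, ?_, ?_⟩
    -- The adjugate of a 1 × 1 matrix is 1, so both remaining moments are `E 1`.
    · simp [Matrix.trace, h1, traceSqMoment_one]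
    · simp [h1, normSqMoment_one]
  | more n ih ih' =>
    intro e he
    refine ⟨hE.detSq_eq u ih' he, hE.detMulTrace_eq u ih' he, ?_, ?_⟩
    · simp only [Matrix.trace, Matrix.diag_apply, sq (∑ i, _), Finset.sum_mul_sum, map_sum]
      rw [sum_sum_eq_of_diag_of_offDiag
        (fun i => by rw [← sq]; exact adjugate_diag_sq_eq u ih' he i)
        (fun i j hij => hE.adjugate_diag_mul_diag_eq u ih he hij), traceSqMoment_add_two]
      push_cast
      ring
    · simp only [map_sum]
      rw [sum_sum_eq_of_diag_of_offDiag (fun i => adjugate_diag_sq_eq u ih' he i)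
        (fun i j hij => hE.adjugate_offDiag_sq_eq u ih he hij), normSqMoment_add_two]
      push_cast
      ring

theorem det_sq (hE : IsStein E) (h1 : E 1 = 1) (u : ℝ) :
    E ((genericMat k u).det ^ 2) = detSqMoment u k := by
  have h := (hE.hasMoments h1 u k id Function.injective_id).detSq
  rwa [prinMat, Matrix.submatrix_id_id] at h

end IsStein

end GOEMoment

/-! ### Moments of one Gaussian variable. -/

namespace ProbabilityTheory

open scoped NNReal

theorem integrable_pow_mul_gaussianPDFReal {v : ℝ≥0} (hv : v ≠ 0) (n : ℕ) :
    Integrable fun x => x ^ n * gaussianPDFReal 0 v x := by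
  have hv' : (0 : ℝ) < v := by positivity
  have h := integrable_rpow_mul_exp_neg_mul_sq (b := 1 / (2 * v)) (by positivity)
    (s := n) (by linarith [n.cast_nonneg (α := ℝ)])
  simp only [Real.rpow_natCast] at h
  refine (h.const_mul (√(2 * Real.pi * v))⁻¹).congr (ae_of_all _ fun x => ?_)
  simp only [gaussianPDFReal, sub_zero]
  rw [show -(1 / (2 * v)) * x ^ 2 = -x ^ 2 / (2 * v) by ring]
  ring

/-- Integration by parts: the derivative of `x ^ n` times the density has integral zero. At `n = 0`
the truncated exponent is harmless because of the factor `n`. -/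
theorem integral_pow_succ_mul_gaussianPDFReal {v : ℝ≥0} (hv : v ≠ 0) (n : ℕ) :
    ∫ x, x ^ (n + 1) * gaussianPDFReal 0 v x =
      v * (n * ∫ x, x ^ (n - 1) * gaussianPDFReal 0 v x) := by
  have hv' : (v : ℝ) ≠ 0 := by exact_mod_cast hv
  have hd : ∀ x : ℝ, HasDerivAt (fun x => x ^ n * gaussianPDFReal 0 v x)
      (n * (x ^ (n - 1) * gaussianPDFReal 0 v x) -
        (v : ℝ)⁻¹ * (x ^ (n + 1) * gaussianPDFReal 0 v x)) x := by
    intro x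
    have h1 : HasDerivAt (gaussianPDFReal 0 v) (-x / v * gaussianPDFReal 0 v x) x := by
      rw [gaussianPDFReal_def]
      have h2 : HasDerivAt (fun x : ℝ => -(x - 0) ^ 2 / (2 * v)) (-x / v) x := by
        have := (((hasDerivAt_id x).sub_const (0 : ℝ)).pow 2).neg.div_const (2 * (v : ℝ))
        refine this.congr_deriv ?_
        simp
        field_simp
      refine (h2.exp.const_mul _).congr_deriv ?_
      ring
    refine ((hasDerivAt_pow n x).mul h1).congr_deriv ?_
    ring
  have i1 := (integrable_pow_mul_gaussianPDFReal hv (n - 1)).const_mul (n : ℝ)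
  have i2 := (integrable_pow_mul_gaussianPDFReal hv (n + 1)).const_mul (v : ℝ)⁻¹
  have h := integral_eq_zero_of_hasDerivAt_of_integrable hd (i1.sub i2)
    (integrable_pow_mul_gaussianPDFReal hv n)
  rw [integral_sub i1 i2, integral_const_mul, integral_const_mul, sub_eq_zero] at h
  rw [h, mul_inv_cancel_left₀ hv']

end ProbabilityTheory

/-! ### The ensemble as independent Gaussian entries. -/

namespace GOEMoment

open MvPolynomial ProbabilityTheory
open scoped NNReal

variable {k : ℕ}

/-- `entryVar` as a nonnegative real number. -/
noncomputable def entryVarNN (z : UpperIdx k) : ℝ≥0 := if z.1.1 = z.1.2 then 1 else 1 / 2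

theorem entryVarNN_ne_zero (z : UpperIdx k) : entryVarNN z ≠ 0 := by
  unfold entryVarNN
  split_ifs <;> simp

theorem coe_entryVarNN (z : UpperIdx k) : (entryVarNN z : ℝ) = entryVar z := by
  unfold entryVarNN entryVar
  split_ifs <;> simp

/-- The joint density of the entries of a `GOE` matrix. -/
noncomputable def entryDensity (x : UpperIdx k → ℝ) : ℝ :=
  ∏ z, gaussianPDFReal 0 (entryVarNN z) (x z)

theorem eval_monomial_mul_entryDensity (x : UpperIdx k → ℝ) (d : UpperIdx k →₀ ℕ) (a : ℝ) :
    eval x (monomial d a) * entryDensity x =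
      a * ∏ z, x z ^ d z * gaussianPDFReal 0 (entryVarNN z) (x z) := by
  rw [eval_monomial, Finsupp.prod_fintype _ _ (fun _ => pow_zero _), entryDensity, mul_assoc,
    ← Finset.prod_mul_distrib]

theorem integrable_eval_mul_entryDensity (p : MvPolynomial (UpperIdx k) ℝ) :
    Integrable fun x => eval x p * entryDensity x := by
  induction p using MvPolynomial.induction_on' with
  | monomial d a =>
    simp only [eval_monomial_mul_entryDensity]
    exact (Integrable.fintype_prod fun z =>
      integrable_pow_mul_gaussianPDFReal (entryVarNN_ne_zero z) (d z)).const_mul a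
  | add p q hp hq =>
    simp only [map_add, add_mul]
    exact hp.add hq

variable (k) in
/-- The expectation of a polynomial in the entries of a `GOE` matrix. -/
noncomputable def expect : MvPolynomial (UpperIdx k) ℝ →ₗ[ℝ] ℝ where
  toFun p := ∫ x, eval x p * entryDensity x
  map_add' p q := by
    simp only [map_add, add_mul]
    exact integral_add (integrable_eval_mul_entryDensity p) (integrable_eval_mul_entryDensity q)
  map_smul' c p := by
    simp only [smul_eval, mul_assoc, integral_const_mul, RingHom.id_apply, smul_eq_mul]

theorem expect_apply (p : MvPolynomial (UpperIdx k) ℝ) :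
    expect k p = ∫ x, eval x p * entryDensity x := rfl

theorem expect_monomial (d : UpperIdx k →₀ ℕ) (a : ℝ) :
    expect k (monomial d a) =
      a * ∏ z, ∫ t, t ^ d z * gaussianPDFReal 0 (entryVarNN z) t := by
  simp only [expect_apply, eval_monomial_mul_entryDensity, integral_const_mul]
  congr 1
  exact integral_fintype_prod_volume_eq_prod
    fun z t => t ^ d z * gaussianPDFReal 0 (entryVarNN z) t

theorem expect_one : expect k 1 = 1 := by
  rw [← C_1, ← monomial_zero', expect_monomial]
  simp [integral_gaussianPDFReal_eq_one 0 (entryVarNN_ne_zero _)]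

/-- On a monomial the expectation factors over the entries, and only the factor of `z` differs
between the two sides; there it is the one-variable identity. -/
theorem isStein_expect : IsStein (expect k) := by
  intro z p
  induction p using MvPolynomial.induction_on' with
  | monomial d a =>
    rw [X, monomial_mul, one_mul, pderiv_monomial, expect_monomial, expect_monomial,
      ← Finset.mul_prod_erase _ _ (Finset.mem_univ z), ← Finset.mul_prod_erase _ _
      (Finset.mem_univ z)]
    have h : ∀ i ∈ Finset.univ.erase z,
        (∫ t, t ^ (Finsupp.single z 1 + d : UpperIdx k →₀ ℕ) i * gaussianPDFReal 0 (entryVarNN i) t) =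
        ∫ t, t ^ (d - Finsupp.single z 1 : UpperIdx k →₀ ℕ) i * gaussianPDFReal 0 (entryVarNN i) t := by
      intro i hi
      have hz : Finsupp.single z 1 i = 0 :=
        Finsupp.single_eq_of_ne (Finset.ne_of_mem_erase hi)
      simp [hz]
    rw [Finset.prod_congr rfl h]
    simp only [Finsupp.add_apply, Finsupp.tsub_apply, Finsupp.single_eq_same, add_comm 1]
    rw [integral_pow_succ_mul_gaussianPDFReal (entryVarNN_ne_zero z), coe_entryVarNN]
    ring
  | add p q hp hq => rw [mul_add, map_add, hp, hq, map_add, map_add, mul_add]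

/-- Each off-diagonal pair occurs twice. Besides the Frobenius norm, this also counts the diagonal
and all upper indices, by taking `f` to be the identity matrix or constantly 1. -/
theorem sum_sum_eq_sum_upperIdx (f : Fin k → Fin k → ℝ) (hf : ∀ i j, f i j = f j i) :
    ∑ i, ∑ j, f i j = ∑ z : UpperIdx k, (if z.1.1 = z.1.2 then 1 else 2) * f z.1.1 z.1.2 := by
  have h1 : ∑ z : UpperIdx k, (if z.1.1 = z.1.2 then 1 else 2) * f z.1.1 z.1.2 =
      ∑ i, ∑ j, if i ≤ j then (if i = j then 1 else 2) * f i j else 0 := by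
    rw [← Finset.sum_subtype (Finset.univ.filter fun p : Fin k × Fin k => p.1 ≤ p.2) (by simp)
      fun p => (if p.1 = p.2 then 1 else 2) * f p.1 p.2, Finset.sum_filter, Fintype.sum_prod_type]
  have h2 : ∑ i, ∑ j, f i j =
      ∑ i, ∑ j, (if i ≤ j then f i j else 0) + ∑ i, ∑ j, if j < i then f i j else 0 := by
    simp only [← Finset.sum_add_distrib]
    refine Finset.sum_congr rfl fun i _ => Finset.sum_congr rfl fun j _ => ?_
    rcases le_or_gt i j with h | h
    · simp [h, h.not_gt]
    · simp [h, h.not_ge]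
  rw [h1, h2, Finset.sum_comm (f := fun i j => if j < i then f i j else 0)]
  simp only [← Finset.sum_add_distrib]
  refine Finset.sum_congr rfl fun i _ => Finset.sum_congr rfl fun j _ => ?_
  rcases lt_trichotomy i j with h | h | h
  · simp [h, h.le, h.ne, hf j i, two_mul]
  · simp [h]
  · simp [h.not_ge, h.not_gt]

theorem frobeniusNorm_symOfUpper_sq (x : UpperIdx k → ℝ) :
    frobeniusNorm (symOfUpper k x) ^ 2 =
      ∑ z : UpperIdx k, (if z.1.1 = z.1.2 then 1 else 2) * x z ^ 2 := by
  have h : ((symOfUpper k x).1 ^ 2).trace = ∑ i, ∑ j, x (upperIdx i j) ^ 2 := by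
    rw [sq, Matrix.trace]
    refine Finset.sum_congr rfl fun i _ => ?_
    rw [Matrix.diag_apply, Matrix.mul_apply]
    refine Finset.sum_congr rfl fun j _ => ?_
    rw [sq, (symOfUpper k x).2.apply i j]
    rfl
  rw [frobeniusNorm, Real.sq_sqrt, h,
    sum_sum_eq_sum_upperIdx _ fun i j => by rw [upperIdx_comm]]
  · refine Finset.sum_congr rfl fun z _ => ?_
    have : upperIdx z.1.1 z.1.2 = z := by
      ext1
      simp [upperIdx, min_eq_left z.2, max_eq_right z.2]
    rw [this]
  · rw [h]
    exact Finset.sum_nonneg fun i _ => Finset.sum_nonneg fun j _ => sq_nonneg _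

theorem card_upperIdx_diag : (Finset.univ.filter fun z : UpperIdx k => z.1.1 = z.1.2).card = k := by
  have h := sum_sum_eq_sum_upperIdx (k := k) (fun i j => if i = j then 1 else 0)
    fun i j => by simp [eq_comm]
  have h' : ∀ z : UpperIdx k, ((if z.1.1 = z.1.2 then 1 else 2) *
      (if z.1.1 = z.1.2 then 1 else 0) : ℝ) = if z.1.1 = z.1.2 then 1 else 0 := by
    intro z
    split_ifs <;> simp
  simp only [h', Finset.sum_ite_eq, Finset.mem_univ, if_true,
    Finset.sum_const, Finset.card_univ, Fintype.card_fin, nsmul_eq_mul, mul_one] at h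
  rw [Finset.sum_boole] at h
  exact_mod_cast h.symm

theorem card_upperIdx : Fintype.card (UpperIdx k) = k * (k + 1) / 2 := by
  have h := sum_sum_eq_sum_upperIdx (k := k) (fun _ _ => 1) fun i j => rfl
  have h' : ∀ z : UpperIdx k, ((if z.1.1 = z.1.2 then 1 else 2) * 1 : ℝ) =
      2 - if z.1.1 = z.1.2 then 1 else 0 := by
    intro z
    split_ifs <;> norm_num
  simp only [h', Finset.sum_sub_distrib, Finset.sum_boole, card_upperIdx_diag, Finset.sum_const,
    Finset.card_univ, Fintype.card_fin, nsmul_eq_mul, mul_one] at h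
  have h2 : k * (k + 1) = Fintype.card (UpperIdx k) * 2 := by
    have : (k * (k + 1) : ℝ) = Fintype.card (UpperIdx k) * 2 := by linarith
    exact_mod_cast this
  omega

/-- Every entry contributes `√π` to the normalization, and the `k` diagonal ones a further `√2`; the
doubled off-diagonal squares in `‖A‖²` match variance 1/2. -/
theorem entryDensity_eq (x : UpperIdx k → ℝ) :
    entryDensity x = 1 / (√2 ^ k * √Real.pi ^ (k * (k + 1) / 2)) *
      Real.exp (-(frobeniusNorm (symOfUpper k x) ^ 2) / 2) := by
  have h : ∀ z : UpperIdx k, gaussianPDFReal 0 (entryVarNN z) (x z) =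
      ((if z.1.1 = z.1.2 then √2 else 1) * √Real.pi)⁻¹ *
        Real.exp (-((if z.1.1 = z.1.2 then 1 else 2) * x z ^ 2) / 2) := by
    intro z
    rw [gaussianPDFReal, coe_entryVarNN, entryVar, sub_zero]
    split_ifs
    · rw [mul_one, Real.sqrt_mul zero_le_two, mul_one, one_mul]
    · congr 1
      · rw [one_mul, mul_one_div, mul_div_cancel_left₀ _ two_ne_zero]
      · congr 1
        ring
  rw [entryDensity, Finset.prod_congr rfl fun z _ => h z, Finset.prod_mul_distrib,
    Finset.prod_inv_distrib, Finset.prod_mul_distrib, Finset.prod_const, ← Real.exp_sum,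
    Finset.card_univ, card_upperIdx, Finset.prod_ite, Finset.prod_const, Finset.prod_const_one,
    mul_one, card_upperIdx_diag, one_div, frobeniusNorm_symOfUpper_sq, ← Finset.sum_div,
    Finset.sum_neg_distrib]

theorem measurable_entry (i j : Fin k) : Measurable fun A : SymMat k => A.1 i j :=
  (measurable_pi_apply j).comp ((measurable_pi_apply i).comp
    (comap_measurable fun A : SymMat k => (fun i j => A.1 i j : Fin k → Fin k → ℝ)))

theorem measurable_frobeniusNorm : Measurable (frobeniusNorm : SymMat k → ℝ) := by
  unfold frobeniusNorm
  refine Measurable.sqrt ?_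
  simp only [sq, Matrix.trace, Matrix.diag_apply, Matrix.mul_apply]
  exact Finset.measurable_sum _ fun i _ => Finset.measurable_sum _ fun j _ =>
    (measurable_entry i j).mul (measurable_entry j i)

theorem measurable_det_sq (u : ℝ) : Measurable fun Q : SymMat k =>
    (Q.1 - u • (1 : Matrix (Fin k) (Fin k) ℝ)).det ^ 2 := by
  refine Measurable.pow_const ?_ 2
  simp only [Matrix.det_apply']
  refine Finset.measurable_sum _ fun σ _ => Measurable.const_mul ?_ _
  exact Finset.measurable_prod _ fun i _ => (measurable_entry _ _).sub_const _

theorem eval_det_genericMat_sq (u : ℝ) (x : UpperIdx k → ℝ) :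
    eval x ((genericMat k u).det ^ 2) =
      ((symOfUpper k x).1 - u • (1 : Matrix (Fin k) (Fin k) ℝ)).det ^ 2 := by
  rw [map_pow, RingHom.map_det]
  congr 2
  ext1 i j
  simp only [RingHom.mapMatrix_apply, Matrix.map_apply, genericMat, Matrix.of_apply, map_sub, eval_X,
    Matrix.sub_apply, Matrix.smul_apply, Matrix.one_apply, smul_eq_mul, mul_ite, mul_one, mul_zero]
  congr 1
  split_ifs <;> simp

/-- The density of `GOE(k)` with respect to Lebesgue measure. -/
noncomputable def goeDensity (A : SymMat k) : ℝ :=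
  1 / (√2 ^ k * √Real.pi ^ (k * (k + 1) / 2)) * Real.exp (-(frobeniusNorm A ^ 2) / 2)

theorem measurable_goeDensity : Measurable (goeDensity : SymMat k → ℝ) :=
  (((measurable_frobeniusNorm.pow_const 2).neg.div_const 2).exp).const_mul _

theorem goeDensity_nonneg (A : SymMat k) : 0 ≤ goeDensity A := by
  unfold goeDensity
  positivity

theorem GOE_eq : GOE k = (lebesgueSym k).withDensity fun A => ENNReal.ofReal (goeDensity A) := rfl

theorem isProbabilityMeasure_GOE : IsProbabilityMeasure (GOE k) := by
  have hi := integrable_eval_mul_entryDensity (1 : MvPolynomial (UpperIdx k) ℝ)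
  have h1 := expect_one (k := k)
  rw [expect_apply] at h1
  simp only [map_one, one_mul] at hi h1
  constructor
  rw [GOE_eq, withDensity_apply _ MeasurableSet.univ, Measure.restrict_univ, lebesgueSym,
    lintegral_map measurable_goeDensity.ennreal_ofReal (measurable_symOfUpper k)]
  simp only [goeDensity, ← entryDensity_eq]
  rw [← ofReal_integral_eq_lintegral_ofReal hi (ae_of_all _ fun x => ?_), h1, ENNReal.ofReal_one]
  simp only [entryDensity_eq, Pi.zero_apply]
  positivity

theorem integrable_GOE_iff {f : SymMat k → ℝ} (hf : Measurable f) :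
    Integrable f (GOE k) ↔ Integrable fun x => f (symOfUpper k x) * entryDensity x := by
  rw [GOE_eq, integrable_withDensity_iff_integrable_smul' measurable_goeDensity.ennreal_ofReal
    (ae_of_all _ fun _ => ENNReal.ofReal_lt_top), lebesgueSym]
  simp only [ENNReal.toReal_ofReal (goeDensity_nonneg _), smul_eq_mul]
  refine (integrable_map_measure (measurable_goeDensity.mul hf).aestronglyMeasurable
    (measurable_symOfUpper k).aemeasurable).trans ?_
  simp only [entryDensity_eq, mul_comm (f _)]
  rfl

theorem integral_GOE {f : SymMat k → ℝ} (hf : Measurable f) :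
    ∫ A, f A ∂(GOE k) = ∫ x, f (symOfUpper k x) * entryDensity x := by
  rw [GOE_eq, integral_withDensity_eq_integral_toReal_smul measurable_goeDensity.ennreal_ofReal
    (ae_of_all _ fun _ => ENNReal.ofReal_lt_top), lebesgueSym]
  simp only [ENNReal.toReal_ofReal (goeDensity_nonneg _), smul_eq_mul]
  refine (integral_map (measurable_symOfUpper k).aemeasurable
    (measurable_goeDensity.mul hf).aestronglyMeasurable).trans ?_
  simp only [entryDensity_eq, mul_comm (f _)]
  rfl

theorem integrable_det_sq (u : ℝ) : Integrable (fun Q : SymMat k =>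
    (Q.1 - u • (1 : Matrix (Fin k) (Fin k) ℝ)).det ^ 2) (GOE k) := by
  rw [integrable_GOE_iff (measurable_det_sq u)]
  simp only [← eval_det_genericMat_sq]
  exact integrable_eval_mul_entryDensity _

theorem integral_det_sq (u : ℝ) :
    ∫ Q : SymMat k, (Q.1 - u • (1 : Matrix (Fin k) (Fin k) ℝ)).det ^ 2 ∂(GOE k) =
      detSqMoment u k := by
  rw [integral_GOE (measurable_det_sq u)]
  simp only [← eval_det_genericMat_sq]
  exact isStein_expect.det_sq expect_one u

end GOEMoment

/-! ### Hermite polynomials and the telescoping sums. -/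

namespace GOEMoment

theorem hasDerivAt_monicHermite_succ (n : ℕ) (u : ℝ) :
    HasDerivAt (fun u => monicHermite u (n + 1)) ((n + 1) * monicHermite u n) u := by
  induction n using Nat.twoStepInduction with
  | zero =>
    simpa [monicHermite] using! hasDerivAt_id u
  | one =>
    have h := ((hasDerivAt_id u).mul (hasDerivAt_id u)).sub_const (1 / 2 : ℝ)
    refine (h.congr_deriv ?_).congr_of_eventuallyEq (.of_forall fun x => ?_)
    · simp only [monicHermite, id]; push_cast; ring
    · simp only [monicHermite, Pi.mul_apply, id]; push_cast; ring
  | more n ih ih' =>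
    have h := ((hasDerivAt_id u).mul ih').sub (ih.const_mul ((n + 1 + 1 : ℝ) / 2))
    refine (h.congr_deriv ?_).congr_of_eventuallyEq (.of_forall fun x => ?_)
    · simp only [monicHermite_add_two, id]; push_cast; ring
    · simp only [monicHermite_add_two, Pi.mul_apply, Pi.sub_apply, id]; push_cast; ring

theorem hasDerivAt_monicHermite (n : ℕ) (u : ℝ) :
    HasDerivAt (fun u => monicHermite u n) (n * monicHermite u (n - 1)) u := by
  cases n with
  | zero => simpa [monicHermite] using hasDerivAt_const u (1 : ℝ)
  | succ n => simpa using hasDerivAt_monicHermite_succ n u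

theorem monicHermite_succ (u : ℝ) (n : ℕ) :
    monicHermite u (n + 1) = u * monicHermite u n - n / 2 * monicHermite u (n - 1) := by
  cases n with
  | zero => simp [monicHermite]
  | succ n => rw [monicHermite_add_two]; simp

theorem iteratedDeriv_exp_neg_sq (n : ℕ) :
    iteratedDeriv n (fun t : ℝ => Real.exp (-(t ^ 2))) =
      fun x => (-2) ^ n * (monicHermite x n * Real.exp (-(x ^ 2))) := by
  induction n with
  | zero => simp [monicHermite]
  | succ n ih =>
    rw [iteratedDeriv_succ, ih]
    funext x
    have h : HasDerivAt (fun t : ℝ => Real.exp (-(t ^ 2))) (-2 * x * Real.exp (-(x ^ 2))) x := by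
      refine ((hasDerivAt_pow 2 x).neg.exp).congr_deriv ?_
      simp only [Pi.neg_apply]
      push_cast
      ring
    have h' := ((hasDerivAt_monicHermite n x).mul h).const_mul ((-2 : ℝ) ^ n)
    refine (HasDerivAt.deriv h').trans ?_
    rw [monicHermite_succ]
    ring

theorem hermiteH_eq (n : ℕ) : hermiteH n = fun x => 2 ^ n * monicHermite x n := by
  funext x
  have h : ((-1) ^ n * (-2) ^ n : ℝ) = 2 ^ n := by rw [← mul_pow]; norm_num
  have h' : Real.exp (x ^ 2) * Real.exp (-(x ^ 2)) = 1 := by rw [← Real.exp_add]; simp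
  rw [hermiteH, iteratedDeriv_exp_neg_sq, ← h]
  linear_combination ((-1) ^ n * (-2) ^ n * monicHermite x n) * h'

theorem hermiteH'_eq (n : ℕ) : hermiteH' n = fun x => 2 ^ n * (n * monicHermite x (n - 1)) := by
  funext x
  rw [hermiteH', hermiteH_eq]
  exact ((hasDerivAt_monicHermite n x).const_mul _).deriv

theorem hermiteH''_eq (n : ℕ) : hermiteH'' n =
    fun x => 2 ^ n * (n * ((n - 1 : ℕ) * monicHermite x (n - 1 - 1))) := by
  funext x
  rw [hermiteH'', hermiteH'_eq]
  exact (((hasDerivAt_monicHermite (n - 1) x).const_mul _).const_mul _).deriv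

/-- With `p n` the monic Hermite polynomial and `p (n+1)' = (n+1) * p n`, the bracket is the
Wronskian `p (n+1) * p (n+2)' - p (n+1)' * p (n+2)`, as in the confluent Christoffel–Darboux
formula. -/
theorem detSqMoment_succ_eq (u : ℝ) (n : ℕ) :
    detSqMoment u (n + 1) = (n + 1) / 2 * detSqMoment u n +
      ((n + 2) * monicHermite u (n + 1) ^ 2 -
        (n + 1) * monicHermite u n * monicHermite u (n + 2)) := by
  simp only [detSqMoment, monicHermite_add_two]
  push_cast
  ring

theorem matX_zero_det (u : ℝ) : (matX 0 u).det = 2 := by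
  simp [matX, Matrix.det_fin_two_of, hermiteH_eq, hermiteH'_eq, hermiteH''_eq, monicHermite]

/-- Two steps of `detSqMoment_succ_eq` make `det X_j` a weighted difference of consecutive even
moments, which is why `sum_matX_det` telescopes. -/
theorem matX_succ_det (u : ℝ) (m : ℕ) : (matX (m + 1) u).det = 2 ^ (4 * m + 5) *
    (detSqMoment u (2 * m + 2) - (2 * m + 2) * (2 * m + 1) / 4 * detSqMoment u (2 * m)) := by
  rw [detSqMoment_succ_eq, detSqMoment_succ_eq]
  simp only [matX, Matrix.det_fin_two_of, hermiteH_eq, hermiteH'_eq, hermiteH''_eq,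
    show 2 * (m + 1) = 2 * m + 2 by ring, Nat.add_sub_cancel,
    show 2 * m + 2 - 1 = 2 * m + 1 by omega, monicHermite_add_two]
  push_cast
  ring

theorem sum_matX_det (u : ℝ) (m : ℕ) :
    ∑ j ∈ Finset.range (m + 1),
      (2 : ℝ) ^ (-2 * (j : ℤ) - 1) / ((2 * j).factorial : ℝ) * (matX j u).det =
    2 ^ (2 * m) / ((2 * m).factorial : ℝ) * detSqMoment u (2 * m) := by
  induction m with
  | zero => simp [matX_zero_det, detSqMoment_zero]
  | succ m ih =>
    have hz : (2 : ℝ) ^ (-2 * ((m + 1 : ℕ) : ℤ) - 1) = (2 ^ (2 * m + 3))⁻¹ := by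
      rw [← zpow_natCast, ← zpow_neg]
      congr 1
    have hf : ((2 * m).factorial : ℝ) ≠ 0 := by positivity
    rw [Finset.sum_range_succ, ih, hz, matX_succ_det, show 2 * (m + 1) = 2 * m + 1 + 1 by ring,
      Nat.factorial_succ, Nat.factorial_succ]
    push_cast
    field_simp
    ring

theorem matY_det (u : ℝ) (m j : ℕ) : (matY m j u).det =
    ((2 * j).factorial : ℝ) / (j.factorial : ℝ) *
      ((hermiteH (2 * j + 1) u - hermiteH' (2 * j) u) * hermiteH' (2 * m + 2) u -
        (hermiteH' (2 * j + 1) u - hermiteH'' (2 * j) u) * hermiteH (2 * m + 2) u) +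
    ((2 * m + 2).factorial : ℝ) / ((m + 1).factorial : ℝ) * (matX j u).det := by
  simp only [matY, matX, Matrix.det_fin_three, Matrix.det_fin_two_of]
  simp
  ring

/-- Telescopes because `H_{2j}' = 4j H_{2j-1}`: after weighting, the subtracted term cancels the
leading term of index `j - 1`. The next lemma is the differentiated version. -/
theorem sum_hermiteH_sub (u : ℝ) (m : ℕ) :
    ∑ j ∈ Finset.range (m + 1), (2 : ℝ) ^ (-2 * (j : ℤ) - 2) / (j.factorial : ℝ) *
      (hermiteH (2 * j + 1) u - hermiteH' (2 * j) u) =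
    (2 ^ (2 * m + 2))⁻¹ / (m.factorial : ℝ) * hermiteH (2 * m + 1) u := by
  induction m with
  | zero => simp [hermiteH'_eq]
  | succ m ih =>
    have hz : (2 : ℝ) ^ (-2 * ((m + 1 : ℕ) : ℤ) - 2) = (2 ^ (2 * m + 4))⁻¹ := by
      rw [← zpow_natCast, ← zpow_neg]
      congr 1
    have hf : (m.factorial : ℝ) ≠ 0 := by positivity
    rw [Finset.sum_range_succ, ih, hz, Nat.factorial_succ]
    simp only [hermiteH_eq, hermiteH'_eq, show 2 * (m + 1) = 2 * m + 2 by ring,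
      show 2 * m + 2 - 1 = 2 * m + 1 by omega]
    push_cast
    field_simp
    ring

theorem sum_hermiteH'_sub (u : ℝ) (m : ℕ) :
    ∑ j ∈ Finset.range (m + 1), (2 : ℝ) ^ (-2 * (j : ℤ) - 2) / (j.factorial : ℝ) *
      (hermiteH' (2 * j + 1) u - hermiteH'' (2 * j) u) =
    (2 ^ (2 * m + 2))⁻¹ / (m.factorial : ℝ) * hermiteH' (2 * m + 1) u := by
  induction m with
  | zero => simp [hermiteH''_eq]
  | succ m ih =>
    have hz : (2 : ℝ) ^ (-2 * ((m + 1 : ℕ) : ℤ) - 2) = (2 ^ (2 * m + 4))⁻¹ := by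
      rw [← zpow_natCast, ← zpow_neg]
      congr 1
    have hf : (m.factorial : ℝ) ≠ 0 := by positivity
    rw [Finset.sum_range_succ, ih, hz, Nat.factorial_succ]
    simp only [hermiteH'_eq, hermiteH''_eq, show 2 * (m + 1) = 2 * m + 2 by ring,
      show 2 * m + 2 - 1 = 2 * m + 1 by omega, Nat.add_sub_cancel]
    push_cast
    field_simp
    ring

theorem sum_matY_det (u : ℝ) (m : ℕ) :
    ∑ j ∈ Finset.range (m + 1),
      (2 : ℝ) ^ (-2 * (j : ℤ) - 2) / ((2 * j).factorial : ℝ) * (matY m j u).det =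
    2 ^ (2 * m + 1) / (m.factorial : ℝ) * ((2 * m + 2) * monicHermite u (2 * m + 1) ^ 2 -
        (2 * m + 1) * monicHermite u (2 * m) * monicHermite u (2 * m + 2)) +
    ((2 * m + 2).factorial : ℝ) / ((m + 1).factorial : ℝ) *
      (2 ^ (2 * m) / (2 * ((2 * m).factorial : ℝ)) * detSqMoment u (2 * m)) := by
  -- The corner `(2j)!/j!` of `Y_j` turns the weight `1/(2j)!` into the `1/j!` of the telescoping
  -- sums, while the cofactor of the bottom-left entry is `det X_j`.
  have h : ∀ j ∈ Finset.range (m + 1),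
      (2 : ℝ) ^ (-2 * (j : ℤ) - 2) / ((2 * j).factorial : ℝ) * (matY m j u).det =
      (2 : ℝ) ^ (-2 * (j : ℤ) - 2) / (j.factorial : ℝ) *
        (hermiteH (2 * j + 1) u - hermiteH' (2 * j) u) * hermiteH' (2 * m + 2) u -
      (2 : ℝ) ^ (-2 * (j : ℤ) - 2) / (j.factorial : ℝ) *
        (hermiteH' (2 * j + 1) u - hermiteH'' (2 * j) u) * hermiteH (2 * m + 2) u +
      (2 : ℝ) ^ (-2 * (j : ℤ) - 1) / ((2 * j).factorial : ℝ) * (matX j u).det *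
        (((2 * m + 2).factorial : ℝ) / ((m + 1).factorial : ℝ) / 2) := by
    intro j _
    have hz : (2 : ℝ) ^ (-2 * (j : ℤ) - 1) = (2 : ℝ) ^ (-2 * (j : ℤ) - 2) * 2 := by
      rw [← zpow_add_one₀ two_ne_zero]
      congr 1
      ring
    have hf : ((2 * j).factorial : ℝ) ≠ 0 := by positivity
    rw [matY_det, hz]
    field_simp
  rw [Finset.sum_congr rfl h, Finset.sum_add_distrib, Finset.sum_sub_distrib, ← Finset.sum_mul,
    ← Finset.sum_mul, ← Finset.sum_mul, sum_hermiteH_sub, sum_hermiteH'_sub, sum_matX_det]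
  have hf : (m.factorial : ℝ) ≠ 0 := by positivity
  have hf' : ((2 * m).factorial : ℝ) ≠ 0 := by positivity
  have hf'' : ((m + 1).factorial : ℝ) ≠ 0 := by positivity
  simp only [hermiteH_eq, hermiteH'_eq, show 2 * m + 2 - 1 = 2 * m + 1 by omega,
    Nat.add_sub_cancel]
  push_cast
  field_simp

theorem Gamma_nat_add_three_halves (m : ℕ) :
    Real.Gamma ((m : ℝ) + 3 / 2) =
      √Real.pi * ((2 * m + 2).factorial : ℝ) / (2 ^ (2 * m + 2) * ((m + 1).factorial : ℝ)) := by
  induction m with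
  | zero =>
    have h : Real.Gamma ((0 : ℕ) + 3 / 2 : ℝ) = 1 / 2 * √Real.pi := by
      rw [← Real.Gamma_one_half_eq, ← Real.Gamma_add_one (by norm_num)]
      norm_num
    rw [h]
    norm_num [Nat.factorial]
    ring
  | succ m ih =>
    have h : ((m + 1 : ℕ) + 3 / 2 : ℝ) = ((m : ℝ) + 3 / 2) + 1 := by push_cast; ring
    have hf : ((m + 1).factorial : ℝ) ≠ 0 := by positivity
    rw [h, Real.Gamma_add_one (by positivity), ih, show 2 * (m + 1) + 2 = 2 * m + 2 + 1 + 1 by ring,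
      Nat.factorial_succ (2 * m + 2 + 1), Nat.factorial_succ (2 * m + 2),
      Nat.factorial_succ (m + 1)]
    push_cast
    field_simp
    ring

theorem detSqMoment_even (u : ℝ) (m : ℕ) : detSqMoment u (2 * m) =
    ((2 * m).factorial : ℝ) / 2 ^ (2 * m) * ∑ j ∈ Finset.range (m + 1),
      (2 : ℝ) ^ (-2 * (j : ℤ) - 1) / ((2 * j).factorial : ℝ) * (matX j u).det := by
  have hf : ((2 * m).factorial : ℝ) ≠ 0 := by positivity
  rw [sum_matX_det]
  field_simp

theorem detSqMoment_odd (u : ℝ) (m : ℕ) : detSqMoment u (2 * m + 1) =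
    √Real.pi * ((2 * m + 1).factorial : ℝ) /
        (2 ^ (4 * m + 2) * Real.Gamma ((m : ℝ) + 3 / 2)) *
      ∑ j ∈ Finset.range (m + 1),
        (2 : ℝ) ^ (-2 * (j : ℤ) - 2) / ((2 * j).factorial : ℝ) * (matY m j u).det := by
  have hf : (m.factorial : ℝ) ≠ 0 := by positivity
  have hf' : ((2 * m).factorial : ℝ) ≠ 0 := by positivity
  have hpi : √Real.pi ≠ 0 := by positivity
  -- Both sides are now the same combination of `detSqMoment u (2 * m)` and one Wronskian; the Gamma
  -- value cancels `√π` and leaves only powers of 2 and factorials.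
  rw [sum_matY_det, Gamma_nat_add_three_halves, detSqMoment_succ_eq,
    Nat.factorial_succ (2 * m + 1), Nat.factorial_succ (2 * m), Nat.factorial_succ m]
  push_cast
  field_simp
  ring

end GOEMoment

theorem proposition4p2 (k : ℕ) (hk : 0 < k) (u : ℝ) :
    MeasureTheory.IsProbabilityMeasure (GOEMoment.GOE k) ∧
    MeasureTheory.Integrable
      (fun Q : GOEMoment.SymMat k => (Q.1 - u • (1 : Matrix (Fin k) (Fin k) ℝ)).det ^ 2)
      (GOEMoment.GOE k) ∧
    (∀ m : ℕ, k = 2 * m →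
      ∫ Q : GOEMoment.SymMat k, (Q.1 - u • (1 : Matrix (Fin k) (Fin k) ℝ)).det ^ 2
          ∂(GOEMoment.GOE k) =
        ((2 * m).factorial : ℝ) / 2 ^ (2 * m) *
          ∑ j ∈ Finset.range (m + 1),
            (2 : ℝ) ^ (-2 * (j : ℤ) - 1) / ((2 * j).factorial : ℝ) *
              (GOEMoment.matX j u).det) ∧
    (∀ m : ℕ, k = 2 * m + 1 →
      ∫ Q : GOEMoment.SymMat k, (Q.1 - u • (1 : Matrix (Fin k) (Fin k) ℝ)).det ^ 2
          ∂(GOEMoment.GOE k) =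
        √Real.pi * ((2 * m + 1).factorial : ℝ) /
            (2 ^ (4 * m + 2) * Real.Gamma ((m : ℝ) + 3 / 2)) *
          ∑ j ∈ Finset.range (m + 1),
            (2 : ℝ) ^ (-2 * (j : ℤ) - 2) / ((2 * j).factorial : ℝ) *
              (GOEMoment.matY m j u).det) := by
  refine ⟨GOEMoment.isProbabilityMeasure_GOE, GOEMoment.integrable_det_sq u, ?_, ?_⟩
  · rintro m rfl
    rw [GOEMoment.integral_det_sq, GOEMoment.detSqMoment_even]
  · rintro m rfl
    rw [GOEMoment.integral_det_sq, GOEMoment.detSqMoment_odd]
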